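/- Let $(X,d)$ be a length space, i.e. a metric space in which the distance between any two points is the infimum of the lengths of the continuous curves joining them, and let $\nu$ be a Borel probability measure on $X$ that is concentrated on a separable subset of $X$ (this is automatic if $X$ is separable, in particular if $X$ is compact). For $t\in[0,1]$ and $x,y\in X$ put $$Z_t(x,y)=\{z\in X:\ d(x,z)=t\,d(x,y),\ d(z,y)=(1-t)\,d(x,y)\}.$$ Let $K>0$ and suppose that $(X,d,\nu)$ satisfies the Prékopa–Leindler inequality $PL(K)$: for every $t\in[0,1]$ and all Borel measurable, everywhere positive, $\nu$-integrable functions $u,v,w$ on $X$ such that $$u(x)^{1-t}\,v(y)^{t}\,\exp\Bigl(-K\,\tfrac{t(1-t)}{2}\,d(x,y)^2\Bigr)\le w(z)\qquad\text{for all } x,y\in X \text{ and } z\in Z_t(x,y),$$ one has $$\Bigl(\int_X u\,d\nu\Bigr)^{1-t}\Bigl(\int_X v\,d\nu\Bigr)^{t}\le\int_X w\,d\nu .$$ Then the transportation inequality $T_2(K)$ holds: for every Borel probability measure $\mu$ on $X$, $$W_2(\mu,\nu)^2\le\frac{2}{K}\,H_\nu(\mu),$$ where $W_2(\mu,\nu)^2=\inf_\pi\int_{X\times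 X}d(x_0,x_1)^2\,d\pi(x_0,x_1)\in[0,\infty]$, the infimum being over all probability measures $\pi$ on $X\times X$ with marginals $\mu$ and $\nu$, and where $H_\nu(\mu)=\int_X\rho\log\rho\,d\nu\in[0,\infty]$ if $\mu$ is absolutely continuous with respect to $\nu$ with density $\rho$, and $H_\nu(\mu)=\infty$ otherwise. -/

import Mathlib

open MeasureTheory Set

/-- The length (total variation) of a continuous path in a metric space, in `[0, ∞]`. -/
noncomputable def pathLength {X : Type*} [MetricSpace X] {x y : X} (γ : Path x y) : ENNReal :=
  eVariationOn γ Set.univ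

/-- A metric space is a length space if the distance between any two points is the infimum of
the lengths of the continuous curves joining them. -/
def IsLengthSpace (X : Type*) [MetricSpace X] : Prop :=
  ∀ x y : X, edist x y = ⨅ γ : Path x y, pathLength γ

/-- The set `Z_t(x, y)` of `t`-intermediate points between `x` and `y`. -/
def intermediatePoints {X : Type*} [MetricSpace X] (t : ℝ) (x y : X) : Set X :=
  {z | dist x z = t * dist x y ∧ dist z y = (1 - t) * dist x y}

/-- The Prékopa–Leindler inequality `PL(K)` for the measure `ν`, tested on Borel, everywhere
positive, `ν`-integrable functions. -/
def SatisfiesPL {X : Type*} [MetricSpace X] [MeasurableSpace X] (ν : Measure X) (K : ℝ) : Prop :=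
  ∀ t ∈ Icc (0 : ℝ) 1, ∀ u v w : X → ℝ,
    Measurable u → Measurable v → Measurable w →
    (∀ x, 0 < u x) → (∀ x, 0 < v x) → (∀ x, 0 < w x) →
    Integrable u ν → Integrable v ν → Integrable w ν →
    (∀ x y : X, ∀ z ∈ intermediatePoints t x y,
      u x ^ (1 - t) * v y ^ t * Real.exp (-K * (t * (1 - t) / 2) * dist x y ^ 2) ≤ w z) →
    (∫ x, u x ∂ν) ^ (1 - t) * (∫ x, v x ∂ν) ^ t ≤ ∫ x, w x ∂ν

/-- The set `Π(μ₀, μ₁)` of measures on `X × X` with marginals `μ₀` and `μ₁`. -/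
def couplings {X : Type*} [MeasurableSpace X] (μ₀ μ₁ : Measure X) : Set (Measure (X × X)) :=
  {π | π.map Prod.fst = μ₀ ∧ π.map Prod.snd = μ₁}

/-- The quadratic Wasserstein distance, with values in `[0, ∞]`:
`W₂(μ₀, μ₁)² = inf_π ∫ d(x₀, x₁)² dπ(x₀, x₁)` over the couplings `π` of `μ₀` and `μ₁`. -/
noncomputable def wasserstein2 {X : Type*} [MetricSpace X] [MeasurableSpace X]
    (μ₀ μ₁ : Measure X) : ENNReal :=
  (⨅ π ∈ couplings μ₀ μ₁, ∫⁻ p, edist p.1 p.2 ^ 2 ∂π) ^ (1 / 2 : ℝ)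

/-- Talagrand's transportation inequality `T₂(K)`, for all Borel probability measures `μ`. The
relative entropy `H_ν(μ)` is `∫ ρ log ρ dν` if `μ = ρ ν`, and `∞` if `μ` is not absolutely
continuous with respect to `ν`; for probability measures this is `InformationTheory.klDiv μ ν`. -/
def SatisfiesT2 {X : Type*} [MetricSpace X] [MeasurableSpace X] (ν : Measure X) (K : ℝ) : Prop :=
  ∀ μ : Measure X, IsProbabilityMeasure μ →
    wasserstein2 μ ν ^ 2 ≤ ENNReal.ofReal (2 / K) * InformationTheory.klDiv μ ν

/-! Write H for the entropy of `μ`; only H < ∞ matters. If φ(x) - F(y) ≤ d(x,y)²/2, the functions u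
= exp(Ktφ), v = exp(-K(1-t)F), w = 1 are admissible in PL(K). Taking logarithms and bounding both
integrals below by the Gibbs inequality (against `μ` for φ, against `ν` itself for F, where it is
Jensen) gives Kt(∫φ dμ - ∫F dν) ≤ H. Letting t → 1 bounds every dual value by H/K
(`SatisfiesPL.integral_sub_integral_le`).

Passing from dual values to couplings needs duality only on finite sets, where it is a Hahn–Banach
separation (`exists_finite_coupling_of_dual_le`). Separability gives a finite partition into small
cells plus one cell of small measure. Potentials on the cells, for the infimum of d²/2 between
cells, pull back to bounded potentials on X, so some discrete coupling costs at most H/K; spreading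
it over the cells by conditional measures couples `μ` and `ν`. The loss comes from the cell
diameters and the exceptional cell. The latter is harmless because `μ` and `ν` have finite second
moments, again by PL(K). -/

/-- A bounded measurable real function is integrable for every finite measure. -/
theorem integrable_of_abs_le {X : Type*} [MeasurableSpace X] {μ : Measure X} [IsFiniteMeasure μ]
    {f : X → ℝ} (hf : Measurable f) {C : ℝ} (hC : ∀ x, |f x| ≤ C) : Integrable f μ :=
  Integrable.of_bound hf.aestronglyMeasurable C (Filter.Eventually.of_forall hC)

theorem integrable_exp_mul_of_abs_le {X : Type*} [MeasurableSpace X] {μ : Measure X}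
    [IsFiniteMeasure μ] {f : X → ℝ} (hf : Measurable f) {C : ℝ} (hC : ∀ x, |f x| ≤ C) (a : ℝ) :
    Integrable (fun x => Real.exp (a * f x)) μ := by
  refine integrable_of_abs_le (C := Real.exp (|a| * C)) (by fun_prop) fun x => ?_
  rw [abs_of_pos (Real.exp_pos _), Real.exp_le_exp]
  calc a * f x ≤ |a * f x| := le_abs_self _
    _ = |a| * |f x| := abs_mul _ _
    _ ≤ |a| * C := by gcongr; exact hC x

/-! ### Entropy and the dual inequality -/

/-- The Gibbs variational inequality (one half of the Donsker–Varadhan formula). -/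
theorem integral_le_klDiv_add_log_integral_exp {X : Type*} [MeasurableSpace X] {μ ν : Measure X}
    [IsProbabilityMeasure μ] [IsProbabilityMeasure ν]
    (hKL : InformationTheory.klDiv μ ν ≠ ⊤) {φ : X → ℝ} (hμ : Integrable φ μ)
    (hν : Integrable (fun x => Real.exp (φ x)) ν) :
    ∫ x, φ x ∂μ ≤ (InformationTheory.klDiv μ ν).toReal + Real.log (∫ x, Real.exp (φ x) ∂ν) := by
  obtain ⟨hac, hint⟩ := InformationTheory.klDiv_ne_top_iff.mp hKL
  -- The gap between the two sides is the divergence of `μ` from `ν.tilted φ`, hence nonnegative.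
  have : IsProbabilityMeasure (ν.tilted φ) := isProbabilityMeasure_tilted hν
  have h1 := integral_llr_tilted_right hac hμ hν hint
  have h2 := InformationTheory.toReal_klDiv_of_measure_eq hac (by simp)
  have h3 := InformationTheory.toReal_klDiv_of_measure_eq
    (hac.trans (absolutelyContinuous_tilted hν)) (by simp)
  have h4 : 0 ≤ (InformationTheory.klDiv μ (ν.tilted φ)).toReal := ENNReal.toReal_nonneg
  linarith

/-- The Prékopa–Leindler inequality with `w = 1`, in logarithmic form. -/
theorem SatisfiesPL.log_integral_exp_le {X : Type*} [MetricSpace X] [MeasurableSpace X]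
    {ν : Measure X} [IsProbabilityMeasure ν] {K : ℝ} (hPL : SatisfiesPL ν K) (hK : 0 < K)
    {φ F : X → ℝ} (hφ : Measurable φ) (hF : Measurable F) {A B : ℝ} (hA : ∀ x, |φ x| ≤ A)
    (hB : ∀ x, |F x| ≤ B) (h : ∀ x y, φ x - F y ≤ dist x y ^ 2 / 2) {t : ℝ}
    (ht : t ∈ Icc (0 : ℝ) 1) :
    (1 - t) * Real.log (∫ x, Real.exp (K * t * φ x) ∂ν) +
      t * Real.log (∫ x, Real.exp (-(K * (1 - t)) * F x) ∂ν) ≤ 0 := by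
  have iφ := integrable_exp_mul_of_abs_le (μ := ν) hφ hA (K * t)
  have iF := integrable_exp_mul_of_abs_le (μ := ν) hF hB (-(K * (1 - t)))
  have key := hPL t ht (fun x => Real.exp (K * t * φ x))
    (fun x => Real.exp (-(K * (1 - t)) * F x)) (fun _ => 1) (by fun_prop) (by fun_prop)
    (by fun_prop) (fun x => Real.exp_pos _) (fun x => Real.exp_pos _) (fun _ => one_pos)
    iφ iF (integrable_const _) (by
      -- The exponents add up to Kt(1-t)(φ(x) - F(y) - d(x,y)²/2).
      intro x y z _
      rw [← Real.exp_mul, ← Real.exp_mul, ← Real.exp_add, ← Real.exp_add, Real.exp_le_one_iff]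
      have := mul_le_mul_of_nonneg_left (h x y)
        (mul_nonneg hK.le (mul_nonneg ht.1 (sub_nonneg.2 ht.2)))
      linarith)
  have pφ : 0 < ∫ x, Real.exp (K * t * φ x) ∂ν := integral_exp_pos iφ
  have pF : 0 < ∫ x, Real.exp (-(K * (1 - t)) * F x) ∂ν := integral_exp_pos iF
  rw [integral_const, probReal_univ, one_smul] at key
  have := Real.log_le_log (by positivity) key
  rwa [Real.log_one, Real.log_mul (by positivity) (by positivity), Real.log_rpow pφ,
    Real.log_rpow pF] at this

/-- The dual form of the transportation inequality, for bounded potentials. -/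
theorem SatisfiesPL.integral_sub_integral_le {X : Type*} [MetricSpace X] [MeasurableSpace X]
    {ν : Measure X} [IsProbabilityMeasure ν] {K : ℝ} (hPL : SatisfiesPL ν K) (hK : 0 < K)
    {μ : Measure X} [IsProbabilityMeasure μ] (hKL : InformationTheory.klDiv μ ν ≠ ⊤)
    {φ F : X → ℝ} (hφ : Measurable φ) (hF : Measurable F) {A B : ℝ} (hA : ∀ x, |φ x| ≤ A)
    (hB : ∀ x, |F x| ≤ B) (h : ∀ x y, φ x - F y ≤ dist x y ^ 2 / 2) :
    ∫ x, φ x ∂μ - ∫ x, F x ∂ν ≤ (InformationTheory.klDiv μ ν).toReal / K := by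
  set H := (InformationTheory.klDiv μ ν).toReal
  set D := ∫ x, φ x ∂μ - ∫ x, F x ∂ν with hD
  have step : ∀ t ∈ Ioo (0 : ℝ) 1, t * (K * D) ≤ H := by
    intro t ht
    have h0 := hPL.log_integral_exp_le hK hφ hF hA hB h (Ioo_subset_Icc_self ht)
    have h1 := integral_le_klDiv_add_log_integral_exp hKL
      ((integrable_of_abs_le (μ := μ) hφ hA).const_mul (K * t))
      (integrable_exp_mul_of_abs_le (μ := ν) hφ hA (K * t))
    -- With both measures equal to `ν` the entropy vanishes and this is Jensen's inequality.
    have h2 := integral_le_klDiv_add_log_integral_exp (μ := ν) (ν := ν) (by simp)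
      ((integrable_of_abs_le (μ := ν) hF hB).const_mul (-(K * (1 - t))))
      (integrable_exp_mul_of_abs_le (μ := ν) hF hB (-(K * (1 - t))))
    rw [integral_const_mul] at h1 h2
    rw [InformationTheory.klDiv_self, ENNReal.toReal_zero, zero_add] at h2
    have h3 := mul_le_mul_of_nonneg_left h1 (sub_nonneg.2 ht.2.le)
    have h4 := mul_le_mul_of_nonneg_left h2 ht.1.le
    have h5 : (1 - t) * (t * (K * D)) ≤ (1 - t) * H := by rw [hD]; linarith
    exact le_of_mul_le_mul_left h5 (sub_pos.2 ht.2)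
  have hlim : Filter.Tendsto (fun t : ℝ => t * (K * D)) (nhdsWithin 1 (Iio 1))
      (nhds (1 * (K * D))) :=
    tendsto_nhdsWithin_of_tendsto_nhds ((continuous_id.mul continuous_const).tendsto 1)
  have hle : 1 * (K * D) ≤ H := le_of_tendsto hlim (by
    filter_upwards [Ioo_mem_nhdsLT (zero_lt_one' ℝ)] with t ht using step t ht)
  rw [le_div_iff₀ hK]
  linarith

/-! ### Finite second moments -/

/-- Measures of finite entropy relative to `ν` have finite second moment. -/
theorem SatisfiesPL.lintegral_edist_sq_lt_top {X : Type*} [MetricSpace X] [MeasurableSpace X]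
    [BorelSpace X]
    {ν : Measure X} [IsProbabilityMeasure ν] {K : ℝ} (hPL : SatisfiesPL ν K) (hK : 0 < K)
    {μ : Measure X} [IsProbabilityMeasure μ] (hKL : InformationTheory.klDiv μ ν ≠ ⊤) (o : X) :
    ∫⁻ x, ENNReal.ofReal (dist x o ^ 2) ∂μ < ⊤ := by
  set H := (InformationTheory.klDiv μ ν).toReal
  obtain ⟨r, hr⟩ : ∃ r : ℕ, 0 < ν (Metric.closedBall o r) := by
    by_contra! hcon
    have : ν (⋃ n : ℕ, Metric.closedBall o n) = 0 :=
      measure_iUnion_null fun n => le_antisymm (hcon n) bot_le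
    rw [Metric.iUnion_closedBall_nat, measure_univ] at this
    exact one_ne_zero this
  set b := (ν (Metric.closedBall o r)).toReal with hb
  have hbpos : 0 < b := ENNReal.toReal_pos hr.ne' (measure_ne_top _ _)
  -- A lower bound for d(x,y)²/2 over all y in the ball. Hence min(g, n) is an admissible potential
  -- against F = 0 on the ball and F = n off it.
  set g : X → ℝ := fun x => max (dist x o - r) 0 ^ 2 / 2 with hg
  have hg0 : ∀ x, 0 ≤ g x := fun x => by positivity
  have hgm : Measurable g := by
    have : Measurable fun x : X => dist x o := (continuous_id.dist continuous_const).measurable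
    fun_prop
  -- From t = 1/2: since exp(-KF/2) has integral at least b, log ∫ exp(Kφ/2) dν ≤ -log b, and Gibbs
  -- bounds (K/2)∫φ dμ by H - log b, uniformly in n.
  set C := 2 / K * (H - Real.log b) with hC
  have bound : ∀ n : ℕ, ∫ x, min (g x) n ∂μ ≤ C := by
    intro n
    have hφm : Measurable fun x => min (g x) n := hgm.min measurable_const
    have hA : ∀ x, |min (g x) n| ≤ (n : ℝ) := fun x => by
      rw [abs_of_nonneg (le_min (hg0 x) n.cast_nonneg)]; exact min_le_right _ _
    have hFm : Measurable ((Metric.closedBall o r)ᶜ.indicator fun _ : X => (n : ℝ)) :=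
      measurable_const.indicator measurableSet_closedBall.compl
    have hB : ∀ x, |(Metric.closedBall o r)ᶜ.indicator (fun _ : X => (n : ℝ)) x| ≤ (n : ℝ) := by
      intro x
      by_cases hx : x ∈ (Metric.closedBall o r)ᶜ <;> simp [indicator, hx]
    have h0 := hPL.log_integral_exp_le hK hφm hFm hA hB (by
      intro x y
      by_cases hy : y ∈ Metric.closedBall o r
      · rw [indicator_of_notMem (by simpa using hy), sub_zero]
        refine (min_le_left _ _).trans ?_
        have h1 : max (dist x o - r) 0 ≤ dist x y :=
          max_le (by have := dist_triangle x y o; rw [Metric.mem_closedBall] at hy; linarith)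
            dist_nonneg
        have : max (dist x o - r) 0 ^ 2 ≤ dist x y ^ 2 :=
          pow_le_pow_left₀ (le_max_right _ _) h1 2
        simp only [hg]; linarith
      · rw [indicator_of_mem (by simpa using hy)]
        have : min (g x) n - n ≤ 0 := sub_nonpos.2 (min_le_right _ _)
        exact this.trans (by positivity)) (t := 1 / 2) (by constructor <;> norm_num)
    have h1 := integral_le_klDiv_add_log_integral_exp hKL
      ((integrable_of_abs_le (μ := μ) hφm hA).const_mul (K * (1 / 2)))
      (integrable_exp_mul_of_abs_le (μ := ν) hφm hA (K * (1 / 2)))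
    rw [integral_const_mul] at h1
    have h2 : Real.log b ≤ Real.log (∫ x, Real.exp (-(K * (1 - 1 / 2)) *
        (Metric.closedBall o r)ᶜ.indicator (fun _ : X => (n : ℝ)) x) ∂ν) := by
      refine Real.log_le_log hbpos ?_
      have : b = ∫ x, (Metric.closedBall o r).indicator (fun _ => (1 : ℝ)) x ∂ν := by
        rw [integral_indicator_const _ measurableSet_closedBall]; simp [hb, Measure.real]
      rw [this]
      refine integral_mono ((integrable_const _).indicator measurableSet_closedBall)
        (integrable_exp_mul_of_abs_le (μ := ν) hFm hB _) fun x => ?_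
      by_cases hx : x ∈ Metric.closedBall o r
      · rw [indicator_of_mem hx]
        beta_reduce
        rw [indicator_of_notMem (by simpa using hx)]
        simp
      · rw [indicator_of_notMem hx]; positivity
    rw [hC, div_mul_eq_mul_div, le_div_iff₀ hK]
    linarith
  have hlin : ∫⁻ x, ENNReal.ofReal (g x) ∂μ ≤ ENNReal.ofReal C := by
    have hsup : ∀ x, ENNReal.ofReal (g x) = ⨆ n : ℕ, ENNReal.ofReal (min (g x) n) := by
      intro x
      refine le_antisymm ?_ (iSup_le fun n => ENNReal.ofReal_le_ofReal (min_le_left _ _))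
      obtain ⟨n, hn⟩ := exists_nat_ge (g x)
      exact le_iSup_of_le n (by rw [min_eq_left hn])
    simp_rw [hsup]
    rw [lintegral_iSup (fun n => (hgm.min measurable_const).ennreal_ofReal)
      (fun m n hmn x => ENNReal.ofReal_le_ofReal (min_le_min_left _ (Nat.cast_le.2 hmn)))]
    refine iSup_le fun n => ?_
    rw [← ofReal_integral_eq_lintegral_ofReal]
    · exact ENNReal.ofReal_le_ofReal (bound n)
    · refine integrable_of_abs_le (C := n) (hgm.min measurable_const) fun x => ?_
      rw [abs_of_nonneg (le_min (hg0 x) n.cast_nonneg)]; exact min_le_right _ _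
    · exact Filter.Eventually.of_forall fun x => le_min (hg0 x) n.cast_nonneg
  calc ∫⁻ x, ENNReal.ofReal (dist x o ^ 2) ∂μ
      ≤ ∫⁻ x, (4 * ENNReal.ofReal (g x) + ENNReal.ofReal (2 * r ^ 2)) ∂μ := by
        refine lintegral_mono fun x => ?_
        rw [show (4 : ENNReal) = ENNReal.ofReal 4 by simp, ← ENNReal.ofReal_mul (by norm_num),
          ← ENNReal.ofReal_add (mul_nonneg (by norm_num) (hg0 x)) (by positivity)]
        refine ENNReal.ofReal_le_ofReal ?_
        have h1 : dist x o ≤ max (dist x o - r) 0 + r := by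
          have := le_max_left (dist x o - r) 0; linarith
        have h2 := pow_le_pow_left₀ dist_nonneg h1 2
        have h3 := sq_nonneg (max (dist x o - r) 0 - r)
        simp only [hg]; nlinarith
    _ = 4 * ∫⁻ x, ENNReal.ofReal (g x) ∂μ + ENNReal.ofReal (2 * r ^ 2) := by
        rw [lintegral_add_right _ measurable_const, lintegral_const_mul _ hgm.ennreal_ofReal,
          lintegral_const, measure_univ, mul_one]
    _ < ⊤ := ENNReal.add_lt_top.2 ⟨ENNReal.mul_lt_top (by simp) (hlin.trans_lt (by simp)),
        ENNReal.ofReal_lt_top⟩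

/-! ### Finite Kantorovich duality -/

/-- Kantorovich duality for finite spaces: if every pair of potentials has dual value at most `C`,
then some coupling has cost at most `C`. -/
theorem exists_finite_coupling_of_dual_le {ι κ : Type*} [Fintype ι] [Fintype κ] [Nonempty κ]
    {p : ι → ℝ} {q : κ → ℝ} (hp : ∀ i, 0 ≤ p i) (hq : ∀ j, 0 ≤ q j) (hp1 : ∑ i, p i = 1)
    (hq1 : ∑ j, q j = 1) (c : ι → κ → ℝ) (C : ℝ)
    (h : ∀ (g : ι → ℝ) (f : κ → ℝ), (∀ i j, g i - f j ≤ c i j) →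
      ∑ i, p i * g i - ∑ j, q j * f j ≤ C) :
    ∃ P : ι → κ → ℝ, (∀ i j, 0 ≤ P i j) ∧ (∀ i, ∑ j, P i j = p i) ∧ (∀ j, ∑ i, P i j = q j) ∧
      ∑ i, ∑ j, P i j * c i j ≤ C := by
  classical
  set S : Set (ι → κ → ℝ) := {P | (∀ i j, 0 ≤ P i j) ∧ ∀ i, ∑ j, P i j = p i} with hS
  have hSconv : Convex ℝ S := by
    rintro P ⟨hP0, hP⟩ Q ⟨hQ0, hQ⟩ a b ha hb hab
    refine ⟨fun i j => ?_, fun i => ?_⟩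
    · have := hP0 i j; have := hQ0 i j
      simp only [Pi.add_apply, Pi.smul_apply, smul_eq_mul]; positivity
    · simp only [Pi.add_apply, Pi.smul_apply, smul_eq_mul, Finset.sum_add_distrib,
        ← Finset.mul_sum, hP, hQ, ← add_mul, hab, one_mul]
  have hScomp : IsCompact S := by
    have hcl : IsClosed S := by
      simp only [hS, ofPred_and, ofPred_forall]
      exact (isClosed_iInter fun i => isClosed_iInter fun j =>
        isClosed_le (by fun_prop) (by fun_prop)).inter
        (isClosed_iInter fun i => isClosed_eq (by fun_prop) (by fun_prop))
    refine (isCompact_univ_pi fun i => isCompact_univ_pi fun _ : κ =>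
      isCompact_Icc (a := (0 : ℝ)) (b := p i)).of_isClosed_subset hcl ?_
    rintro P ⟨hP0, hP⟩ i - j -
    exact ⟨hP0 i j, hP i ▸ Finset.single_le_sum (fun k _ => hP0 i k) (Finset.mem_univ j)⟩
  -- Column marginals and cost: the claim is that the image of `S` meets {q} × (-∞, C]. Otherwise
  -- the two sets are strictly separated by a functional (a, s).
  let Λ : (ι → κ → ℝ) →ₗ[ℝ] (κ → ℝ) × ℝ :=
    { toFun := fun P => (fun j => ∑ i, P i j, ∑ i, ∑ j, P i j * c i j)
      map_add' := fun P Q => by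
        ext <;> simp [Finset.sum_add_distrib, add_mul]
      map_smul' := fun a P => by
        ext <;> simp [Finset.mul_sum, mul_assoc] }
  have hΛ : Continuous Λ := LinearMap.continuous_of_finiteDimensional Λ
  by_cases hdis : Disjoint (Λ '' S) ({q} ×ˢ Iic C)
  swap
  · obtain ⟨_, ⟨P, hPS, rfl⟩, hP⟩ := not_disjoint_iff.1 hdis
    exact ⟨P, hPS.1, hPS.2, fun j => congrFun hP.1 j, hP.2⟩
  exfalso
  obtain ⟨ℓ, u, v, hu, huv, hv⟩ := geometric_hahn_banach_compact_closed
    (hSconv.linear_image Λ) (hScomp.image hΛ) ((convex_singleton q).prod (convex_Iic C))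
    (isClosed_singleton.prod isClosed_Iic) hdis
  set a : κ → ℝ := fun j => ℓ (Pi.single j 1, 0) with ha
  set s : ℝ := ℓ (0, 1) with hs
  have hℓ : ∀ (m : κ → ℝ) (r : ℝ), ℓ (m, r) = ∑ j, m j * a j + r * s := by
    intro m r
    have h1 : (m, r) = ∑ j, m j • ((Pi.single j 1, 0) : (κ → ℝ) × ℝ) + r • (0, 1) := by
      ext
      · simp [Prod.fst_sum, Finset.sum_apply, Pi.single_apply]
      · simp [Prod.snd_sum]
    rw [h1, map_add, map_sum]
    simp only [map_smul, smul_eq_mul, ha, hs]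
  have hlt : ∀ P ∈ S, ∀ r ≤ C, ∑ j, (∑ i, P i j) * a j + (∑ i, ∑ j, P i j * c i j) * s <
      ∑ j, q j * a j + r * s := by
    intro P hP r hr
    rw [← hℓ, ← hℓ]
    exact (hu _ ⟨P, hP, rfl⟩).trans (huv.trans (hv (q, r) ⟨rfl, hr⟩))
  have hprod : (fun i j => p i * q j) ∈ S :=
    ⟨fun i j => mul_nonneg (hp i) (hq j), fun i => by rw [← Finset.mul_sum, hq1, mul_one]⟩
  -- The product plan already has column marginal `q`, so only the cost coordinate can separate its
  -- image from points of lower cost.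
  have hsneg : s < 0 := by
    have h1 := fun r hr => hlt _ hprod r hr
    simp_rw [← Finset.sum_mul, hp1, one_mul] at h1
    set D := ∑ i, ∑ j, p i * q j * c i j
    by_contra! hs0
    have h2 := h1 (min C D) (min_le_left _ _)
    have h3 := mul_le_mul_of_nonneg_right (min_le_right C D) hs0
    linarith
  -- The normalised separating functional is the potential. Its partner is g(i) = min_j (c i j + f
  -- j), and sending all of p i to a minimiser `J i` turns the separation into a dual value
  -- exceeding `C`.
  set f : κ → ℝ := fun j => a j / s with hf
  choose J hJ using fun i => Finite.exists_min fun j => c i j + f j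
  have hdual := h (fun i => c i (J i) + f (J i)) f fun i j => by linarith [hJ i j]
  have hPJ : (fun i j => if j = J i then p i else 0) ∈ S :=
    ⟨fun i j => by beta_reduce; split_ifs; exacts [hp i, le_rfl], fun i => by simp⟩
  have h1 := hlt _ hPJ C le_rfl
  have haf : ∀ j, a j = f j * s := fun j => (div_mul_cancel₀ _ hsneg.ne).symm
  simp only [haf, Finset.sum_mul, ite_mul, zero_mul] at h1
  rw [Finset.sum_comm] at h1
  simp only [Finset.sum_ite_eq', Finset.mem_univ, if_true] at h1
  have h2 : (∑ i, p i * (c i (J i) + f (J i))) * s < (∑ j, q j * f j + C) * s := by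
    simp only [Finset.sum_mul, add_mul, mul_add, Finset.sum_add_distrib, mul_assoc] at h1 ⊢
    linarith
  have h3 := lt_of_mul_lt_mul_of_nonpos_right h2 hsneg.le
  linarith

/-! ### Discretisation and lifting of couplings -/

/-- A finite measure concentrated on a separable set admits finite measurable partitions, all of
whose pieces but one have small diameter, and the exceptional piece has small measure. -/
theorem exists_finite_measurable_partition {X : Type*} [MetricSpace X] [MeasurableSpace X]
    [BorelSpace X] [Nonempty X] (m : Measure X) [IsFiniteMeasure m] {S : Set X}
    (hS : TopologicalSpace.IsSeparable S) (hm : m Sᶜ = 0) {ε : ℝ} (hε : 0 < ε) {δ : ENNReal}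
    (hδ : 0 < δ) :
    ∃ (N : ℕ) (T : X → Fin (N + 1)), Measurable T ∧ m (T ⁻¹' {0}) ≤ δ ∧
      ∀ x y, T x = T y → T x ≠ 0 → dist x y ≤ ε := by
  classical
  obtain ⟨c, hc, hSc⟩ := hS
  obtain ⟨u, hu⟩ := countable_iff_exists_subset_range.1 hc
  -- Shifting the index reserves 0, the value of `Nat.findGreatest` when no ball with index 1, …, N
  -- contains x, for the exceptional cell.
  set B : ℕ → Set X := fun k => Metric.closedBall (u (k - 1)) (ε / 2) with hB
  have hBm : ∀ k, MeasurableSet (B k) := fun k => measurableSet_closedBall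
  set R : ℕ → Set X := fun n => ⋂ k, ⋂ (_ : 0 < k ∧ k ≤ n), (B k)ᶜ with hR
  have hRm : ∀ n, MeasurableSet (R n) := fun n =>
    MeasurableSet.iInter fun k => MeasurableSet.iInter fun _ => (hBm k).compl
  have hRanti : Antitone R := fun a b hab =>
    iInter_mono fun k => iInter_mono' fun hk => ⟨⟨hk.1, hk.2.trans hab⟩, subset_rfl⟩
  have hRnull : m (⋂ n, R n) = 0 := by
    refine measure_mono_null (t := Sᶜ) (fun x hx hxS => ?_) hm
    obtain ⟨y, hy, hxy⟩ := Metric.mem_closure_iff.1 (hSc hxS) (ε / 2) (half_pos hε)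
    obtain ⟨k, rfl⟩ := hu hy
    have h1 := mem_iInter.1 hx (k + 1)
    simp only [hR, mem_iInter] at h1
    exact h1 (k + 1) ⟨k.succ_pos, le_rfl⟩ hxy.le
  have hlim := tendsto_measure_iInter_atTop (μ := m) (fun n => (hRm n).nullMeasurableSet) hRanti
    ⟨0, measure_ne_top _ _⟩
  rw [hRnull] at hlim
  obtain ⟨N, hN⟩ := (hlim.eventually_le_const hδ).exists
  have hT : Measurable fun x => Nat.findGreatest (fun k => x ∈ B k) N :=
    measurable_findGreatest fun k _ => hBm k
  refine ⟨N, fun x => ⟨Nat.findGreatest (fun k => x ∈ B k) N,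
    Nat.lt_succ_of_le (Nat.findGreatest_le N)⟩, ?_, ?_, ?_⟩
  · refine measurable_to_countable' fun i => ?_
    have : MeasurableSet ((fun x => Nat.findGreatest (fun k => x ∈ B k) N) ⁻¹' {(i : ℕ)}) :=
      hT (measurableSet_singleton _)
    convert this using 1
    ext x
    simp [Fin.ext_iff]
  · refine (measure_mono fun x hx => ?_).trans hN
    have hx0 : Nat.findGreatest (fun k => x ∈ B k) N = 0 := congrArg Fin.val hx
    rw [Nat.findGreatest_eq_zero_iff] at hx0
    simp only [hR, mem_iInter]
    exact fun k hk => hx0 hk.1 hk.2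
  · intro x y hxy hx
    have hxy' : Nat.findGreatest (fun k => x ∈ B k) N = Nat.findGreatest (fun k => y ∈ B k) N :=
      congrArg Fin.val hxy
    have hx' : Nat.findGreatest (fun k => x ∈ B k) N ≠ 0 := fun h => hx (Fin.ext h)
    have h1 := Nat.findGreatest_of_ne_zero (P := fun k => x ∈ B k) rfl hx'
    have h2 := Nat.findGreatest_of_ne_zero (P := fun k => y ∈ B k) hxy'.symm hx'
    have := dist_triangle_right x y (u (Nat.findGreatest (fun k => x ∈ B k) N - 1))
    have h3 := Metric.mem_closedBall.1 h1
    have h4 := Metric.mem_closedBall.1 h2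
    linarith

/-- A coupling of the discretisations of `μ` and `ν` lifts to a coupling of `μ` and `ν`. -/
theorem exists_coupling_lintegral_le {X : Type*} [MeasurableSpace X] {μ ν : Measure X}
    [IsProbabilityMeasure μ] [IsProbabilityMeasure ν] {ι : Type*} [Fintype ι] [MeasurableSpace ι]
    [MeasurableSingletonClass ι] {T : X → ι} (hT : Measurable T) {P : ι → ι → ℝ}
    (hP : ∀ i j, 0 ≤ P i j) (hrow : ∀ i, ∑ j, P i j = μ.real (T ⁻¹' {i}))
    (hcol : ∀ j, ∑ i, P i j = ν.real (T ⁻¹' {j})) (c : ι → ι → ENNReal) :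
    ∃ π ∈ couplings μ ν, ∫⁻ z, c (T z.1) (T z.2) ∂π ≤ ∑ i, ∑ j, ENNReal.ofReal (P i j) * c i j := by
  have hTm : ∀ i, MeasurableSet (T ⁻¹' {i}) := fun i => hT (measurableSet_singleton i)
  have hμ : ∀ i, ∑ j, ENNReal.ofReal (P i j) = μ (T ⁻¹' {i}) := fun i => by
    rw [← ENNReal.ofReal_sum_of_nonneg fun j _ => hP i j, hrow, ofReal_measureReal]
  have hν : ∀ j, ∑ i, ENNReal.ofReal (P i j) = ν (T ⁻¹' {j}) := fun j => by
    rw [← ENNReal.ofReal_sum_of_nonneg fun i _ => hP i j, hcol, ofReal_measureReal]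
  -- On a null cell the conditional measure is zero rather than a probability, but then the weight
  -- `P i j` vanishes too.
  have hμ1 : ∀ i j, ENNReal.ofReal (P i j) * ProbabilityTheory.cond μ (T ⁻¹' {i}) univ =
      ENNReal.ofReal (P i j) := by
    intro i j
    by_cases h : μ (T ⁻¹' {i}) = 0
    · have : ENNReal.ofReal (P i j) = 0 := (Finset.sum_eq_zero_iff.1 ((hμ i).trans h)) j
        (Finset.mem_univ j)
      rw [this, zero_mul]
    · have := ProbabilityTheory.cond_isProbabilityMeasure h
      rw [measure_univ, mul_one]
  have hν1 : ∀ i j, ENNReal.ofReal (P i j) * ProbabilityTheory.cond ν (T ⁻¹' {j}) univ =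
      ENNReal.ofReal (P i j) := by
    intro i j
    by_cases h : ν (T ⁻¹' {j}) = 0
    · have : ENNReal.ofReal (P i j) = 0 := (Finset.sum_eq_zero_iff.1 ((hν j).trans h)) i
        (Finset.mem_univ i)
      rw [this, zero_mul]
    · have := ProbabilityTheory.cond_isProbabilityMeasure h
      rw [measure_univ, mul_one]
  refine ⟨∑ i, ∑ j, ENNReal.ofReal (P i j) • (ProbabilityTheory.cond μ (T ⁻¹' {i})).prod
    (ProbabilityTheory.cond ν (T ⁻¹' {j})), ⟨?_, ?_⟩, ?_⟩
  · ext s hs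
    rw [Measure.map_apply measurable_fst hs, ← prod_univ]
    conv_rhs => rw [← ProbabilityTheory.sum_meas_smul_cond_fiber hT μ]
    simp only [Measure.coe_finsetSum, Finset.sum_apply, Measure.smul_apply, smul_eq_mul,
      Measure.prod_prod]
    refine Finset.sum_congr rfl fun i _ => ?_
    rw [← hμ i, Finset.sum_mul]
    refine Finset.sum_congr rfl fun j _ => ?_
    rw [mul_comm (ProbabilityTheory.cond μ _ s), ← mul_assoc, hν1]
  · ext s hs
    rw [Measure.map_apply measurable_snd hs, ← univ_prod]
    conv_rhs => rw [← ProbabilityTheory.sum_meas_smul_cond_fiber hT ν]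
    simp only [Measure.coe_finsetSum, Finset.sum_apply, Measure.smul_apply, smul_eq_mul,
      Measure.prod_prod]
    rw [Finset.sum_comm]
    refine Finset.sum_congr rfl fun j _ => ?_
    rw [← hν j, Finset.sum_mul]
    refine Finset.sum_congr rfl fun i _ => ?_
    rw [← mul_assoc, hμ1]
  · simp only [lintegral_finsetSum_measure, lintegral_smul_measure, smul_eq_mul]
    refine Finset.sum_le_sum fun i _ => Finset.sum_le_sum fun j _ => ?_
    have hae : ∀ᵐ z ∂(ProbabilityTheory.cond μ (T ⁻¹' {i})).prod
        (ProbabilityTheory.cond ν (T ⁻¹' {j})), c (T z.1) (T z.2) = c i j := by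
      have h1 := Measure.quasiMeasurePreserving_fst.ae
        (μa := (ProbabilityTheory.cond μ (T ⁻¹' {i})).prod
          (ProbabilityTheory.cond ν (T ⁻¹' {j}))) (ProbabilityTheory.ae_cond_mem (μ := μ) (hTm i))
      have h2 := Measure.quasiMeasurePreserving_snd.ae
        (μa := (ProbabilityTheory.cond μ (T ⁻¹' {i})).prod
          (ProbabilityTheory.cond ν (T ⁻¹' {j}))) (ProbabilityTheory.ae_cond_mem (μ := ν) (hTm j))
      filter_upwards [h1, h2] with z hz1 hz2
      rw [show T z.1 = i from hz1, show T z.2 = j from hz2]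
    rw [lintegral_congr_ae hae, lintegral_const, ← univ_prod_univ, Measure.prod_prod,
      mul_comm (c i j), ← mul_assoc, ← mul_assoc, hμ1, hν1]

theorem integral_comp_eq_sum_measureReal {X ι : Type*} [MeasurableSpace X] [Fintype ι]
    [MeasurableSpace ι] [MeasurableSingletonClass ι] (μ : Measure X) [IsFiniteMeasure μ]
    {T : X → ι} (hT : Measurable T) (g : ι → ℝ) :
    ∫ x, g (T x) ∂μ = ∑ i, μ.real (T ⁻¹' {i}) * g i := by
  rw [← integral_map hT.aemeasurable (measurable_of_finite g).aestronglyMeasurable,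
    integral_fintype Integrable.of_finite]
  simp [Measure.real, Measure.map_apply hT (measurableSet_singleton _)]

/-- Under the Prékopa–Leindler inequality, every cost on a finite quotient of `X` that is dominated
by the quadratic cost satisfies the transportation inequality. -/
theorem SatisfiesPL.exists_finite_coupling {X : Type*} [MetricSpace X] [MeasurableSpace X]
    {ν : Measure X} [IsProbabilityMeasure ν] {K : ℝ} (hPL : SatisfiesPL ν K) (hK : 0 < K)
    {μ : Measure X} [IsProbabilityMeasure μ] (hKL : InformationTheory.klDiv μ ν ≠ ⊤)
    {ι : Type*} [Fintype ι] [MeasurableSpace ι] [MeasurableSingletonClass ι] {T : X → ι}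
    (hT : Measurable T) {c : ι → ι → ℝ} (hc : ∀ x y, c (T x) (T y) ≤ dist x y ^ 2 / 2) :
    ∃ P : ι → ι → ℝ, (∀ i j, 0 ≤ P i j) ∧ (∀ i, ∑ j, P i j = μ.real (T ⁻¹' {i})) ∧
      (∀ j, ∑ i, P i j = ν.real (T ⁻¹' {j})) ∧
      ∑ i, ∑ j, P i j * c i j ≤ (InformationTheory.klDiv μ ν).toReal / K := by
  obtain ⟨x₀⟩ : Nonempty X := nonempty_of_isProbabilityMeasure ν
  have : Nonempty ι := ⟨T x₀⟩
  have hsum : ∀ (m : Measure X) [IsProbabilityMeasure m], ∑ i, m.real (T ⁻¹' {i}) = 1 := by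
    intro m _
    have := integral_comp_eq_sum_measureReal m hT (fun _ => 1)
    simpa using this.symm
  have hbd : ∀ (g : ι → ℝ) (x : X), |g (T x)| ≤ ∑ i, |g i| := fun g x =>
    Finset.single_le_sum (f := fun i => |g i|) (fun i _ => abs_nonneg _) (Finset.mem_univ (T x))
  refine exists_finite_coupling_of_dual_le (fun i => measureReal_nonneg)
    (fun j => measureReal_nonneg) (hsum μ) (hsum ν) c _ fun g f hgf => ?_
  rw [← integral_comp_eq_sum_measureReal μ hT g, ← integral_comp_eq_sum_measureReal ν hT f]
  exact hPL.integral_sub_integral_le hK hKL ((measurable_of_finite g).comp hT)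
    ((measurable_of_finite f).comp hT) (hbd g) (hbd f)
    fun x y => (hgf (T x) (T y)).trans (hc x y)

theorem tendsto_lintegral_ofReal_sub_natCast {X : Type*} [MeasurableSpace X] {μ : Measure X}
    {h : X → ℝ} (hm : Measurable h) (hfin : ∫⁻ x, ENNReal.ofReal (h x) ∂μ < ⊤) :
    Filter.Tendsto (fun n : ℕ => ∫⁻ x, ENNReal.ofReal (h x - n) ∂μ) Filter.atTop (nhds 0) := by
  rw [← lintegral_zero (μ := μ)]
  refine tendsto_lintegral_of_dominated_convergence (fun x => ENNReal.ofReal (h x))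
    (fun n => (hm.sub measurable_const).ennreal_ofReal)
    (fun n => Filter.Eventually.of_forall fun x => ENNReal.ofReal_le_ofReal
      (sub_le_self _ n.cast_nonneg)) hfin.ne (Filter.Eventually.of_forall fun x => ?_)
  obtain ⟨N, hN⟩ := exists_nat_ge (h x)
  refine tendsto_const_nhds.congr' ?_
  filter_upwards [Filter.eventually_ge_atTop N] with n hn
  exact (ENNReal.ofReal_of_nonpos (sub_nonpos.2 (hN.trans (Nat.cast_le.2 hn)))).symm

/-! ### Comparison of the quotient cost with the quadratic cost -/

/-- The largest cost on a quotient of `X` that is dominated by the quadratic cost. -/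
noncomputable def quotientCost {X ι : Type*} [MetricSpace X] (T : X → ι) (i j : ι) : ℝ :=
  sInf {r | ∃ x y, T x = i ∧ T y = j ∧ r = dist x y ^ 2 / 2}

theorem quotientCost_nonneg {X ι : Type*} [MetricSpace X] (T : X → ι) (i j : ι) :
    0 ≤ quotientCost T i j :=
  Real.sInf_nonneg (by rintro _ ⟨x, y, -, -, rfl⟩; positivity)

theorem quotientCost_le {X ι : Type*} [MetricSpace X] (T : X → ι) (x y : X) :
    quotientCost T (T x) (T y) ≤ dist x y ^ 2 / 2 :=
  csInf_le ⟨0, by rintro _ ⟨x, y, -, -, rfl⟩; positivity⟩ ⟨x, y, rfl, rfl, rfl⟩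

theorem dist_sq_le_quotientCost {X ι : Type*} [MetricSpace X] {T : X → ι} {η : ℝ} (hη : 0 < η)
    {x y : X} (hx : ∀ x', T x = T x' → dist x x' ≤ η / 2)
    (hy : ∀ y', T y = T y' → dist y y' ≤ η / 2) :
    dist x y ^ 2 ≤ 2 * (1 + η) * quotientCost T (T x) (T y) + (η + η ^ 2) := by
  suffices (dist x y ^ 2 - (η + η ^ 2)) / (2 * (1 + η)) ≤ quotientCost T (T x) (T y) by
    rw [div_le_iff₀ (by positivity)] at this
    linarith
  refine le_csInf ⟨_, x, y, rfl, rfl, rfl⟩ ?_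
  rintro _ ⟨x', y', hx', hy', rfl⟩
  have h1 : dist x y ≤ dist x' y' + η := by
    have := dist_triangle4 x x' y' y
    have := hx x' hx'.symm
    have := hy y' hy'.symm
    rw [dist_comm y y'] at this
    linarith
  have h2 := pow_le_pow_left₀ dist_nonneg h1 2
  -- Absorbs the cross term of (d' + η)² via 2ηd' ≤ η(d'² + 1), where d' is `dist x' y'`.
  have h3 := mul_nonneg hη.le (sq_nonneg (dist x' y' - 1))
  rw [div_le_iff₀ (by positivity)]
  linarith

/-- If a point lies in the exceptional cell, d(x,y)² ≤ 2d(x,o)² + 2d(y,o)² is split at level L, and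
the indicators pay for the constant 4L. The error is a function of x plus a function of y, so its
integral against a coupling depends only on the marginals. -/
theorem edist_sq_le_add_indicator {X : Type*} [MetricSpace X] {N : ℕ} {T : X → Fin (N + 1)} {η : ℝ}
    (hη : 0 < η) (hT : ∀ x y, T x = T y → T x ≠ 0 → dist x y ≤ η / 2) (o : X) (L : ℕ) (x y : X) :
    edist x y ^ 2 ≤ ENNReal.ofReal (2 * (1 + η)) * ENNReal.ofReal (quotientCost T (T x) (T y)) +
      ENNReal.ofReal (η + η ^ 2) +
      (4 * L * (T ⁻¹' {0}).indicator 1 x + 2 * ENNReal.ofReal (dist x o ^ 2 - L)) +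
      (4 * L * (T ⁻¹' {0}).indicator 1 y + 2 * ENNReal.ofReal (dist y o ^ 2 - L)) := by
  rw [edist_dist, ← ENNReal.ofReal_pow dist_nonneg]
  by_cases hbad : T x ≠ 0 ∧ T y ≠ 0
  · refine le_trans ?_ (le_self_add.trans le_self_add)
    rw [← ENNReal.ofReal_mul (by positivity), ← ENNReal.ofReal_add
      (mul_nonneg (by positivity) (quotientCost_nonneg T _ _)) (by positivity)]
    exact ENNReal.ofReal_le_ofReal (dist_sq_le_quotientCost hη (fun x' h => hT x x' h hbad.1)
      fun y' h => hT y y' h hbad.2)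
  · have h1 : (4 * L : ENNReal) ≤ 4 * L * (T ⁻¹' {0}).indicator 1 x +
        4 * L * (T ⁻¹' {0}).indicator 1 y := by
      rw [not_and_or, not_not, not_not] at hbad
      rcases hbad with h | h
      · rw [indicator_of_mem (show x ∈ T ⁻¹' {0} from h)]
        simp
      · rw [indicator_of_mem (show y ∈ T ⁻¹' {0} from h)]
        simp
    have h2 : dist x y ^ 2 ≤ 4 * L + 2 * (dist x o ^ 2 - L) + 2 * (dist y o ^ 2 - L) := by
      have := pow_le_pow_left₀ dist_nonneg (dist_triangle_right x y o) 2
      have := sq_nonneg (dist x o - dist y o)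
      linarith
    calc ENNReal.ofReal (dist x y ^ 2)
        ≤ ENNReal.ofReal (4 * L + 2 * (dist x o ^ 2 - L) + 2 * (dist y o ^ 2 - L)) :=
          ENNReal.ofReal_le_ofReal h2
      _ ≤ ENNReal.ofReal (4 * L) + ENNReal.ofReal (2 * (dist x o ^ 2 - L)) +
          ENNReal.ofReal (2 * (dist y o ^ 2 - L)) :=
          ENNReal.ofReal_add_le.trans (by gcongr; exact ENNReal.ofReal_add_le)
      _ = 4 * L + 2 * ENNReal.ofReal (dist x o ^ 2 - L) +
          2 * ENNReal.ofReal (dist y o ^ 2 - L) := by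
          rw [ENNReal.ofReal_mul zero_le_two, ENNReal.ofReal_mul zero_le_two,
            ENNReal.ofReal_mul zero_le_four]
          simp
      _ ≤ (4 * L * (T ⁻¹' {0}).indicator 1 x + 4 * L * (T ⁻¹' {0}).indicator 1 y) +
          2 * ENNReal.ofReal (dist x o ^ 2 - L) + 2 * ENNReal.ofReal (dist y o ^ 2 - L) := by
          gcongr
      _ = (4 * L * (T ⁻¹' {0}).indicator 1 x + 2 * ENNReal.ofReal (dist x o ^ 2 - L)) +
          (4 * L * (T ⁻¹' {0}).indicator 1 y + 2 * ENNReal.ofReal (dist y o ^ 2 - L)) := by ring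
      _ ≤ _ := add_le_add le_add_self le_rfl

/-! ### Almost optimal couplings and the conclusion -/

/-- Couplings of almost optimal quadratic cost. -/
theorem SatisfiesPL.exists_coupling {X : Type*} [MetricSpace X] [MeasurableSpace X] [BorelSpace X]
    {ν : Measure X} [IsProbabilityMeasure ν]
    (hν : ∃ S : Set X, TopologicalSpace.IsSeparable S ∧ ν Sᶜ = 0) {K : ℝ} (hPL : SatisfiesPL ν K)
    (hK : 0 < K) {μ : Measure X} [IsProbabilityMeasure μ]
    (hKL : InformationTheory.klDiv μ ν ≠ ⊤) {η : ℝ} (hη : 0 < η) :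
    ∃ π ∈ couplings μ ν, ∫⁻ z, edist z.1 z.2 ^ 2 ∂π ≤
      ENNReal.ofReal (2 * (1 + η) * ((InformationTheory.klDiv μ ν).toReal / K) + (η + η ^ 2) +
        6 * η) := by
  set H := (InformationTheory.klDiv μ ν).toReal
  have hac := (InformationTheory.klDiv_ne_top_iff.1 hKL).1
  obtain ⟨S, hS, hνS⟩ := hν
  have hX : Nonempty X := nonempty_of_isProbabilityMeasure ν
  obtain ⟨o⟩ := id hX
  have hhm : Measurable fun x : X => dist x o ^ 2 :=
    ((continuous_id.dist continuous_const).pow 2).measurable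
  have hηpos : 0 < ENNReal.ofReal η := ENNReal.ofReal_pos.2 hη
  obtain ⟨L, hLμ, hLν⟩ := (((tendsto_lintegral_ofReal_sub_natCast hhm
    (hPL.lintegral_edist_sq_lt_top hK hKL o)).eventually_le_const hηpos).and
    ((tendsto_lintegral_ofReal_sub_natCast hhm (hPL.lintegral_edist_sq_lt_top (μ := ν) hK (by simp)
      o)).eventually_le_const hηpos)).exists
  -- `L` is fixed first, from the second-moment tails; the exceptional cell then has mass at most
  -- η/(4L + 1), so that 4L times it is at most η. Each marginal thus contributes at most η + 2η to
  -- the error.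
  obtain ⟨N, T, hTm, hTbad, hT⟩ := exists_finite_measurable_partition (μ + ν) hS
    (by simp [hνS, hac hνS]) (half_pos hη) (δ := ENNReal.ofReal (η / (4 * L + 1)))
    (ENNReal.ofReal_pos.2 (by positivity))
  obtain ⟨P, hP0, hPμ, hPν, hPc⟩ := hPL.exists_finite_coupling hK hKL hTm (quotientCost_le T)
  obtain ⟨π, hπ, hπc⟩ := exists_coupling_lintegral_le hTm hP0 hPμ hPν
    fun i j => ENNReal.ofReal (quotientCost T i j)
  refine ⟨π, hπ, ?_⟩
  have hπ1 : π univ = 1 := by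
    rw [← preimage_univ (f := Prod.fst), ← Measure.map_apply measurable_fst MeasurableSet.univ,
      hπ.1, measure_univ]
  set G : X → ENNReal := fun x =>
    4 * L * (T ⁻¹' {0}).indicator 1 x + 2 * ENNReal.ofReal (dist x o ^ 2 - L) with hG
  have hbadm : MeasurableSet (T ⁻¹' {0}) := hTm (measurableSet_singleton 0)
  have hG1 : Measurable fun x : X => (4 * L : ENNReal) * (T ⁻¹' {0}).indicator 1 x :=
    (measurable_one.indicator hbadm).const_mul _
  have hG2 : Measurable fun x : X => ENNReal.ofReal (dist x o ^ 2 - L) :=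
    (hhm.sub measurable_const).ennreal_ofReal
  have hGm : Measurable G := hG1.add (hG2.const_mul _)
  have hGint : ∀ m : Measure X, m ≤ μ + ν →
      ∫⁻ x, ENNReal.ofReal (dist x o ^ 2 - L) ∂m ≤ ENNReal.ofReal η →
      ∫⁻ x, G x ∂m ≤ ENNReal.ofReal (3 * η) := by
    intro m hm hmL
    simp only [hG]
    rw [lintegral_add_left hG1, lintegral_const_mul _ (measurable_one.indicator hbadm),
      lintegral_indicator_one hbadm, lintegral_const_mul _ hG2]
    calc 4 * L * m (T ⁻¹' {0}) + 2 * ∫⁻ x, ENNReal.ofReal (dist x o ^ 2 - L) ∂m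
        ≤ 4 * L * ENNReal.ofReal (η / (4 * L + 1)) + 2 * ENNReal.ofReal η := by
          gcongr
          exact (hm _).trans hTbad
      _ = ENNReal.ofReal (4 * L * (η / (4 * L + 1)) + 2 * η) := by
          rw [ENNReal.ofReal_add (by positivity) (by positivity),
            ENNReal.ofReal_mul (by positivity), ENNReal.ofReal_mul zero_le_two,
            ENNReal.ofReal_mul zero_le_four]
          simp
      _ ≤ ENNReal.ofReal (3 * η) := by
          refine ENNReal.ofReal_le_ofReal ?_
          have : 4 * L * (η / (4 * L + 1)) ≤ η := by
            rw [mul_div_assoc', div_le_iff₀ (by positivity)]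
            linarith
          linarith
  have hcm : Measurable fun z : X × X => ENNReal.ofReal (quotientCost T (T z.1) (T z.2)) :=
    (measurable_of_finite fun p : Fin (N + 1) × Fin (N + 1) =>
      ENNReal.ofReal (quotientCost T p.1 p.2)).comp
      ((hTm.comp measurable_fst).prodMk (hTm.comp measurable_snd))
  have hcost : ∫⁻ z, ENNReal.ofReal (quotientCost T (T z.1) (T z.2)) ∂π ≤
      ENNReal.ofReal (H / K) := by
    refine hπc.trans ?_
    refine le_trans (le_of_eq ?_) (ENNReal.ofReal_le_ofReal hPc)
    have hnn : ∀ i j, 0 ≤ P i j * quotientCost T i j := fun i j =>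
      mul_nonneg (hP0 i j) (quotientCost_nonneg T i j)
    rw [ENNReal.ofReal_sum_of_nonneg fun i _ => Finset.sum_nonneg fun j _ => hnn i j]
    refine Finset.sum_congr rfl fun i _ => ?_
    rw [ENNReal.ofReal_sum_of_nonneg fun j _ => hnn i j]
    exact Finset.sum_congr rfl fun j _ => (ENNReal.ofReal_mul (hP0 i j)).symm
  have hG1z : Measurable fun z : X × X => G z.1 := hGm.comp measurable_fst
  have hG2z : Measurable fun z : X × X => G z.2 := hGm.comp measurable_snd
  have hH : 0 ≤ H / K := div_nonneg ENNReal.toReal_nonneg hK.le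
  calc ∫⁻ z, edist z.1 z.2 ^ 2 ∂π
      ≤ ∫⁻ z, (ENNReal.ofReal (2 * (1 + η)) *
          ENNReal.ofReal (quotientCost T (T z.1) (T z.2)) + ENNReal.ofReal (η + η ^ 2) +
          G z.1 + G z.2) ∂π :=
        lintegral_mono fun z => edist_sq_le_add_indicator hη hT o L z.1 z.2
    _ = ENNReal.ofReal (2 * (1 + η)) *
          ∫⁻ z, ENNReal.ofReal (quotientCost T (T z.1) (T z.2)) ∂π + ENNReal.ofReal (η + η ^ 2) +
          ∫⁻ x, G x ∂μ + ∫⁻ x, G x ∂ν := by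
        rw [lintegral_add_right _ hG2z,
          lintegral_add_right _ hG1z, lintegral_add_right _ measurable_const,
          lintegral_const_mul _ hcm, lintegral_const, hπ1, mul_one,
          ← lintegral_map hGm measurable_fst, ← lintegral_map hGm measurable_snd, hπ.1, hπ.2]
    _ ≤ ENNReal.ofReal (2 * (1 + η)) * ENNReal.ofReal (H / K) + ENNReal.ofReal (η + η ^ 2) +
          ENNReal.ofReal (3 * η) + ENNReal.ofReal (3 * η) := by
        gcongr
        · exact hGint μ (Measure.le_add_right le_rfl) hLμ
        · exact hGint ν (Measure.le_add_left le_rfl) hLν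
    _ = _ := by
        rw [← ENNReal.ofReal_mul (by positivity), ← ENNReal.ofReal_add (by positivity)
          (by positivity), ← ENNReal.ofReal_add (by positivity) (by positivity),
          ← ENNReal.ofReal_add (by positivity) (by positivity)]
        congr 1
        ring

theorem wasserstein2_sq {X : Type*} [MetricSpace X] [MeasurableSpace X] (μ ν : Measure X) :
    wasserstein2 μ ν ^ 2 = ⨅ π ∈ couplings μ ν, ∫⁻ p, edist p.1 p.2 ^ 2 ∂π := by
  rw [wasserstein2, ← ENNReal.rpow_natCast, ← ENNReal.rpow_mul]
  norm_num

theorem mainTheorem5 {X : Type*} [MetricSpace X] [MeasurableSpace X] [BorelSpace X]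
    (hX : IsLengthSpace X) (ν : Measure X) [IsProbabilityMeasure ν]
    (hν : ∃ S : Set X, TopologicalSpace.IsSeparable S ∧ ν Sᶜ = 0)
    (K : ℝ) (hK : 0 < K) (hPL : SatisfiesPL ν K) :
    SatisfiesT2 ν K := by
  intro μ _
  by_cases hKL : InformationTheory.klDiv μ ν = ⊤
  · rw [hKL, ENNReal.mul_top (ENNReal.ofReal_pos.2 (by positivity)).ne']
    exact le_top
  rw [wasserstein2_sq]
  set H := (InformationTheory.klDiv μ ν).toReal with hH
  have hlim : Filter.Tendsto (fun η : ℝ => ENNReal.ofReal (2 * (1 + η) * (H / K) + (η + η ^ 2) +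
      6 * η)) (nhdsWithin 0 (Ioi 0)) (nhds (ENNReal.ofReal (2 * (1 + 0) * (H / K) + (0 + 0 ^ 2) +
      6 * 0))) := by
    refine tendsto_nhdsWithin_of_tendsto_nhds (Continuous.tendsto ?_ 0)
    exact ENNReal.continuous_ofReal.comp (by fun_prop)
  refine (ge_of_tendsto hlim ?_).trans (le_of_eq ?_)
  · filter_upwards [self_mem_nhdsWithin] with η hη
    obtain ⟨π, hπ, hle⟩ := hPL.exists_coupling hν hK hKL hη
    exact (iInf₂_le π hπ).trans hle
  · rw [← ENNReal.ofReal_toReal hKL, ← hH, ← ENNReal.ofReal_mul (by positivity)]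
    congr 1
    ring
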